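/- Let $X$ be a finite simple undirected graph with $N$ vertices and adjacency matrix $d\in M_N(\{0,1\})$. Let $C(G^+(X))$ be the universal unital $\mathrm{C}^*$-algebra generated by elements $u_{ij}$ ($1\le i,j\le N$), subject to the relations that the $u_{ij}$ are projections ($u_{ij}=u_{ij}^2=u_{ij}^*$) which sum up to $1$ on each row and each column of $u=(u_{ij})$, and that $du=ud$. With the comultiplication given by $\Delta(u_{ij})=\sum_k u_{ik}\otimes u_{kj}$, this defines a compact quantum group $G^+(X)$, the quantum automorphism group of $X$. For a finite group $\Gamma$, its dual $\widehat{\Gamma}$ is the compact quantum group given by the group algebra $\mathrm{C}^*(\Gamma)=\mathbb{C}[\Gamma]$, with involution $g^*=g^{-1}$ and comultiplication $\Delta(g)=g\otimes g$ for $g\in\Gamma$. A compact quantum group $G$ has the Frucht property if $G=G^+(X)$ for some finite graph $X$, i.e. if the dense $*$-algebra $\langle u_{ij}\rangle\subset C(G^+(X))$ is isomorphic to the Hopf $*$-algebra of $G$ by a $*$-isomorphism that intertwines the comultiplications. **Theorem.** The finite duals $\widehat{S_3}$, $\widehat{A_4}$ and $\widehat{A_5}$ do not have the Frucht property: none of them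 is the quantum automorphism group of a finite graph. -/

import Mathlib

open scoped ENNReal TensorProduct

noncomputable section

/-! ### Magic matrices and the quantum automorphism group of a finite graph -/

/-- A square matrix over a `*`-algebra is magic if its entries are projections `p = p² = p*`
which sum up to `1` on every row and on every column. -/
structure IsMagic {V A : Type*} [Fintype V] [Semiring A] [StarRing A]
    (u : Matrix V V A) : Prop where
  isStarProjection : ∀ i j, IsStarProjection (u i j)
  row_sum : ∀ i, ∑ j, u i j = 1
  col_sum : ∀ j, ∑ i, u i j = 1

open Classical in
/-- The relations `u = magic`, `du = ud`, with `d` the adjacency matrix of the graph `X`. -/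
structure IsQuantumAut {V A : Type*} [Fintype V] [Semiring A] [StarRing A]
    (X : SimpleGraph V) (u : Matrix V V A) : Prop where
  isMagic : IsMagic u
  adj_comm : X.adjMatrix A * u = u * X.adjMatrix A

/-- A (nonzero, unital) `C*`-algebra with a matrix that satisfies the relations `u = magic`,
`du = ud` of the graph `X`.

Every `C*`-algebra that is generated by the entries of such a matrix is separable, hence has a copy
in `Type`: no representation of the relations is lost by keeping to `Type`. -/
structure QuantumAutModel {V : Type} [Fintype V] (X : SimpleGraph V) : Type 1 where
  carrier : Type
  [cstar : CStarAlgebra carrier]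
  [nontriv : Nontrivial carrier]
  mat : Matrix V V carrier
  isQuantumAut : IsQuantumAut X mat

namespace QuantumAutModel

variable {V : Type} [Fintype V] {X : SimpleGraph V}

instance (M : QuantumAutModel X) : CStarAlgebra M.carrier := M.cstar

instance (M : QuantumAutModel X) : Nontrivial M.carrier := M.nontriv

end QuantumAutModel

section Universal

variable {V : Type} [Fintype V] (X : SimpleGraph V)

/-- The `ℓ^∞`-product of all models of the relations. -/
abbrev ModelProduct : Type 1 := lp (fun M : QuantumAutModel X => M.carrier) ∞

instance : CStarAlgebra (ModelProduct X) where

/-- The tuple of the `(i, j)` entries of the matrices of all models. -/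
def ModelProduct.entry (i j : V) : ModelProduct X :=
  ⟨fun M => M.mat i j, memℓp_infty ⟨1, by
    rintro _ ⟨M, rfl⟩
    exact IsStarProjection.norm_le _ (M.isQuantumAut.isMagic.isStarProjection i j)⟩⟩

/-- The universal `C*`-algebra `C(G⁺(X))` generated by the entries of a magic matrix `u` with
`du = ud`: the closed `*`-subalgebra generated by the entries of the universal tuple, i.e. the
completion of the polynomials in the `u_ij` for the norm `sup ‖π(·)‖` over all models `π`. -/
def QuantumAutAlgebra : StarSubalgebra ℂ (ModelProduct X) :=
  (StarAlgebra.adjoin ℂ {a | ∃ i j, a = ModelProduct.entry X i j}).topologicalClosure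

instance : CStarAlgebra (QuantumAutAlgebra X) :=
  StarSubalgebra.cstarAlgebra _ (h_closed := StarSubalgebra.isClosed_topologicalClosure _)

/-- The fundamental magic matrix of `C(G⁺(X))`. -/
def QuantumAutAlgebra.u : Matrix V V (QuantumAutAlgebra X) := fun i j =>
  ⟨ModelProduct.entry X i j, StarSubalgebra.le_topologicalClosure _
    (StarAlgebra.subset_adjoin ℂ _ ⟨i, j, rfl⟩)⟩

/-- The dense `*`-subalgebra `⟨u_ij⟩` of `C(G⁺(X))`. -/
def QuantumAutPoly : StarSubalgebra ℂ (QuantumAutAlgebra X) :=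
  StarAlgebra.adjoin ℂ {a | ∃ i j, a = QuantumAutAlgebra.u X i j}

/-- The fundamental magic matrix, with entries in `⟨u_ij⟩`. -/
def QuantumAutPoly.u : Matrix V V (QuantumAutPoly X) := fun i j =>
  ⟨QuantumAutAlgebra.u X i j, StarAlgebra.subset_adjoin ℂ _ ⟨i, j, rfl⟩⟩

/-- The evaluation of `C(G⁺(X))` at a model. -/
def QuantumAutAlgebra.eval (M : QuantumAutModel X) : QuantumAutAlgebra X →⋆ₐ[ℂ] M.carrier where
  toFun a := (a : ModelProduct X) M
  map_one' := rfl
  map_mul' _ _ := rfl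
  map_zero' := rfl
  map_add' _ _ := rfl
  commutes' _ := rfl
  map_star' _ := rfl

/-- The fundamental matrix satisfies the relations of the graph. -/
theorem QuantumAutAlgebra.isQuantumAut : IsQuantumAut X (QuantumAutAlgebra.u X) := by
  classical
  have ext {a b : QuantumAutAlgebra X} (h : ∀ M, eval X M a = eval X M b) : a = b :=
    Subtype.ext (lp.ext (funext h))
  refine ⟨⟨fun i j => ⟨ext fun M => ?_, ext fun M => ?_⟩, fun i => ext fun M => ?_,
    fun j => ext fun M => ?_⟩, Matrix.ext fun i j => ext fun M => ?_⟩
  · exact (M.isQuantumAut.isMagic.isStarProjection i j).isIdempotentElem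
  · exact (M.isQuantumAut.isMagic.isStarProjection i j).isSelfAdjoint
  · rw [map_sum, map_one]
    exact M.isQuantumAut.isMagic.row_sum i
  · rw [map_sum, map_one]
    exact M.isQuantumAut.isMagic.col_sum j
  · have h := congrFun (congrFun M.isQuantumAut.adj_comm i) j
    simp only [SimpleGraph.adjMatrix_mul_apply, SimpleGraph.mul_adjMatrix_apply, map_sum] at h ⊢
    exact h

/-- The universal property of `C(G⁺(X))`. -/
theorem QuantumAutAlgebra.existsUnique_lift {B : Type} [CStarAlgebra B] [Nontrivial B]
    (w : Matrix V V B) (hw : IsQuantumAut X w) :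
    ∃! f : QuantumAutAlgebra X →⋆ₐ[ℂ] B, ∀ i j, f (QuantumAutAlgebra.u X i j) = w i j := by
  refine ⟨eval X ⟨B, w, hw⟩, fun _ _ => rfl, fun f hf => ?_⟩
  have hcont (g : QuantumAutAlgebra X →⋆ₐ[ℂ] B) : Continuous g :=
    AddMonoidHomClass.continuous_of_bound g 1 fun a => by
      simpa using NonUnitalStarAlgHom.norm_apply_le g a
  refine StarAlgHom.ext_topologicalClosure (hcont _) (hcont _) ?_
  refine StarAlgHom.ext_adjoin ?_
  rintro ⟨x, hx⟩ ⟨i, j, rfl⟩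
  exact hf i j

end Universal

/-! ### The group algebra of a discrete group as a Hopf `*`-algebra -/

section GroupAlgebra

variable {Γ : Type*} [Group Γ]

/-- The involution of the group algebra: `(∑ c_g g)* = ∑ conj(c_g) g⁻¹`. -/
instance : Star (MonoidAlgebra ℂ Γ) where
  star a := a.coeff.sum fun g c => MonoidAlgebra.single g⁻¹ (star c)

theorem MonoidAlgebra.star_single' (g : Γ) (c : ℂ) :
    star (MonoidAlgebra.single g c) = MonoidAlgebra.single g⁻¹ (star c) := by
  change (MonoidAlgebra.single g c).coeff.sum _ = _
  rw [MonoidAlgebra.coeff_single]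
  exact Finsupp.sum_single_index (by simp)

theorem MonoidAlgebra.star_add' (a b : MonoidAlgebra ℂ Γ) : star (a + b) = star a + star b := by
  change (a + b).coeff.sum _ = a.coeff.sum _ + b.coeff.sum _
  rw [MonoidAlgebra.coeff_add]
  exact Finsupp.sum_add_index' (by simp) (by simp [MonoidAlgebra.single_add])

instance : StarRing (MonoidAlgebra ℂ Γ) where
  star_involutive a := by
    induction a using MonoidAlgebra.induction_linear with
    | zero => exact Finsupp.sum_zero_index
    | add a b ha hb => rw [MonoidAlgebra.star_add', MonoidAlgebra.star_add', ha, hb]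
    | single g c => simp [MonoidAlgebra.star_single']
  star_mul a b := by
    have h0 : star (0 : MonoidAlgebra ℂ Γ) = 0 := Finsupp.sum_zero_index
    induction a using MonoidAlgebra.induction_linear with
    | zero => simp [h0]
    | add a₁ a₂ h₁ h₂ => simp only [add_mul, mul_add, MonoidAlgebra.star_add', h₁, h₂]
    | single g c =>
      induction b using MonoidAlgebra.induction_linear with
      | zero => simp [h0]
      | add b₁ b₂ h₁ h₂ => simp only [add_mul, mul_add, MonoidAlgebra.star_add', h₁, h₂]
      | single h d =>
        simp [MonoidAlgebra.star_single', MonoidAlgebra.single_mul_single, mul_comm]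
  star_add := MonoidAlgebra.star_add'

end GroupAlgebra

/-! ### The Frucht property -/

/-- Let `A` be the Hopf `*`-algebra of a compact quantum group `G` (for the dual of a group `Γ`, the
group algebra `ℂ[Γ]`). `G` has the Frucht property if `G = G⁺(X)` for some finite graph `X`: there
is an isomorphism of `*`-algebras `⟨u_ij⟩ ≃ A` that intertwines the comultiplications. As the
comultiplication of `G⁺(X)` is the morphism given by `u_ij ↦ ∑_k u_ik ⊗ u_kj` on the generators,
the latter means that the comultiplication of `A` is given by this formula on the images of the
generators. -/
def HasFruchtProperty (A : Type*) [Ring A] [StarRing A] [Bialgebra ℂ A] : Prop :=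
  ∃ (N : ℕ) (X : SimpleGraph (Fin N)) (φ : QuantumAutPoly X ≃⋆ₐ[ℂ] A), ∀ i j,
    Coalgebra.comul (R := ℂ) (φ (QuantumAutPoly.u X i j)) =
      ∑ k, φ (QuantumAutPoly.u X i k) ⊗ₜ[ℂ] φ (QuantumAutPoly.u X k j)

end

/-! Suppose `ℂ[Γ]` is the Hopf `*`-algebra of `G⁺(X)`, with fundamental matrix `v = ∑ g, P_g g`. The
scalar matrices `P_g` are pairwise orthogonal idempotents (`sum_coeff_mul_coeff`), and since `v` is
magic, the group elements occurring in one row commute (`commute_of_coeff_ne_zero`). In the three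
groups commuting is transitive on nontrivial elements, so the centralizers of nontrivial elements
are abelian and meet pairwise in `1` or coincide. Take a character `χ` of one centralizer and let
`f` be `χ` there and `1` elsewhere. Although `f` need not be multiplicative on `Γ`, it is so on the
support of each entry of `v`. Hence `f(v)` is a scalar magic matrix, and it commutes with the
adjacency matrix by linearity. The universal property turns it into a character of `ℂ[Γ]`, that is,
a character of `Γ` which agrees with `f` on the generating set of elements occurring in `v`
(`HasFruchtProperty.exists_extension`). Two noncommuting generators can thus be separated by
characters of `Γ` in both directions. This is impossible when the abelianization is trivial (`A₅`)
or of prime order (`S₃`, `A₄`). -/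

open scoped TensorProduct

/-! ### Coefficients, projections and functionals on `ℂ[Γ]`. -/

section GroupAlgebraCoefficients

/-- The linear functional on the group algebra with prescribed values on the group elements. -/
noncomputable def MonoidAlgebra.functional {Γ : Type*} [Fintype Γ] (f : Γ → ℂ) :
    MonoidAlgebra ℂ Γ →ₗ[ℂ] ℂ where
  toFun a := ∑ g, f g * a.coeff g
  map_add' a b := by simp [mul_add, Finset.sum_add_distrib]
  map_smul' c a := by simp [Finset.mul_sum, mul_left_comm]

theorem MonoidAlgebra.functional_apply {Γ : Type*} [Fintype Γ] (f : Γ → ℂ)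
    (a : MonoidAlgebra ℂ Γ) : MonoidAlgebra.functional f a = ∑ g, f g * a.coeff g := rfl

variable {Γ : Type*} [Group Γ]

theorem MonoidAlgebra.coeff_star_apply (a : MonoidAlgebra ℂ Γ) (g : Γ) :
    (star a).coeff g = star (a.coeff g⁻¹) := by
  induction a using MonoidAlgebra.induction_linear with
  | zero => simp
  | add a b ha hb => simp [ha, hb]
  | single h c =>
    classical
    rw [MonoidAlgebra.star_single']
    simp only [MonoidAlgebra.coeff_single, Finsupp.single_apply, inv_eq_iff_eq_inv, apply_ite star,
      star_zero]

variable [Fintype Γ]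

theorem MonoidAlgebra.coeff_mul_eq_sum [DecidableEq Γ] (a b : MonoidAlgebra ℂ Γ) (m : Γ) :
    (a * b).coeff m = ∑ g, ∑ h, if g * h = m then a.coeff g * b.coeff h else 0 := by
  rw [MonoidAlgebra.coeff_mul, Finsupp.sum_fintype _ _ (by simp)]
  refine Finset.sum_congr rfl fun g _ => ?_
  rw [Finsupp.sum_fintype _ _ (by simp)]

theorem MonoidAlgebra.coeff_star_mul_self_one (a : MonoidAlgebra ℂ Γ) :
    (star a * a).coeff 1 = ((∑ g, ‖a.coeff g‖ ^ 2 : ℝ) : ℂ) := by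
  classical
  rw [MonoidAlgebra.coeff_mul_eq_sum, ← Equiv.sum_comp (Equiv.inv Γ)]
  push_cast
  refine Finset.sum_congr rfl fun g _ => ?_
  simp only [Equiv.inv_apply, inv_mul_eq_one, Finset.sum_ite_eq, Finset.mem_univ, if_true,
    MonoidAlgebra.coeff_star_apply, inv_inv]
  exact Complex.conj_mul' _

/-- Projections of a group algebra that sum up to `1` are pairwise orthogonal. -/
theorem MonoidAlgebra.mul_eq_zero_of_sum_eq_one {ι : Type*} [Fintype ι]
    {p : ι → MonoidAlgebra ℂ Γ} (hp : ∀ i, IsStarProjection (p i)) (hsum : ∑ i, p i = 1)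
    {j k : ι} (hjk : j ≠ k) : p j * p k = 0 := by
  classical
  have hstar (i : ι) : star (p i * p k) * (p i * p k) = p k * p i * p k := by
    rw [star_mul, (hp i).isSelfAdjoint.star_eq, (hp k).isSelfAdjoint.star_eq]
    rw [mul_assoc, ← mul_assoc (p i), (hp i).isIdempotentElem.eq, mul_assoc]
  -- Compress `∑ i, p i = 1` by `p k` and cancel the term `i = k`. The coefficient at `1` is a
  -- faithful positive trace, so each remaining term vanishes.
  have h1 : ∑ i ∈ Finset.univ.erase k, star (p i * p k) * (p i * p k) = 0 := by
    have h2 : ∑ i, p k * p i * p k = p k := by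
      rw [← Finset.sum_mul, ← Finset.mul_sum, hsum, mul_one, (hp k).isIdempotentElem.eq]
    rw [← Finset.add_sum_erase _ _ (Finset.mem_univ k), (hp k).isIdempotentElem.eq,
      (hp k).isIdempotentElem.eq] at h2
    simpa only [hstar] using add_eq_left.mp h2
  have h3 := congrArg (fun a => a.coeff (1 : Γ)) h1
  simp only [MonoidAlgebra.coeff_sum, Finsupp.finsetSum_apply,
    MonoidAlgebra.coeff_star_mul_self_one, MonoidAlgebra.coeff_zero, Finsupp.coe_zero,
    Pi.zero_apply] at h3
  norm_cast at h3
  rw [Finset.sum_eq_zero_iff_of_nonneg fun i _ => Finset.sum_nonneg fun g _ => by positivity] at h3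
  have h4 := h3 j (by simp [hjk])
  rw [Finset.sum_eq_zero_iff_of_nonneg fun g _ => by positivity] at h4
  ext g
  simpa using h4 g (Finset.mem_univ g)

theorem MonoidAlgebra.functional_one {f : Γ → ℂ} (hf : f 1 = 1) :
    MonoidAlgebra.functional f 1 = 1 := by
  classical
  simp [MonoidAlgebra.functional_apply, MonoidAlgebra.one_def, Finsupp.single_apply, hf]

/-- Multiplicativity is asked only on the supports, because the `f` used later is not a character of
`Γ`. -/
theorem MonoidAlgebra.functional_mul {f : Γ → ℂ} {a b : MonoidAlgebra ℂ Γ}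
    (hf : ∀ g h, a.coeff g ≠ 0 → b.coeff h ≠ 0 → f (g * h) = f g * f h) :
    MonoidAlgebra.functional f (a * b) =
      MonoidAlgebra.functional f a * MonoidAlgebra.functional f b := by
  classical
  simp only [MonoidAlgebra.functional_apply, MonoidAlgebra.coeff_mul_eq_sum, Finset.sum_mul]
  simp only [Finset.mul_sum]
  rw [Finset.sum_comm]
  refine Finset.sum_congr rfl fun g _ => ?_
  rw [Finset.sum_comm]
  refine Finset.sum_congr rfl fun h _ => ?_
  simp only [mul_ite, mul_zero, Finset.sum_ite_eq, Finset.mem_univ, if_true]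
  by_cases ha : a.coeff g = 0
  · simp [ha]
  by_cases hb : b.coeff h = 0
  · simp [hb]
  rw [hf g h ha hb]
  ring

theorem MonoidAlgebra.functional_star {f : Γ → ℂ} {a : MonoidAlgebra ℂ Γ}
    (hf : ∀ g, a.coeff g ≠ 0 → f g⁻¹ = star (f g)) :
    MonoidAlgebra.functional f (star a) = star (MonoidAlgebra.functional f a) := by
  simp only [MonoidAlgebra.functional_apply, star_sum]
  rw [← Equiv.sum_comp (Equiv.inv Γ)]
  refine Finset.sum_congr rfl fun g _ => ?_
  simp only [Equiv.inv_apply, MonoidAlgebra.coeff_star_apply, inv_inv, star_mul']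
  by_cases ha : a.coeff g = 0
  · simp [ha]
  rw [hf g ha]

theorem MonoidAlgebra.isStarProjection_functional {f : Γ → ℂ} {a : MonoidAlgebra ℂ Γ}
    (ha : IsStarProjection a)
    (hmul : ∀ g h, a.coeff g ≠ 0 → a.coeff h ≠ 0 → f (g * h) = f g * f h)
    (hinv : ∀ g, a.coeff g ≠ 0 → f g⁻¹ = star (f g)) :
    IsStarProjection (MonoidAlgebra.functional f a) where
  isIdempotentElem := by
    rw [IsIdempotentElem, ← MonoidAlgebra.functional_mul hmul, ha.isIdempotentElem.eq]
  isSelfAdjoint := by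
    rw [IsSelfAdjoint, ← MonoidAlgebra.functional_star hinv, ha.isSelfAdjoint.star_eq]

theorem MonoidAlgebra.functional_of_map {F : Type*} [FunLike F (MonoidAlgebra ℂ Γ) ℂ]
    [AlgHomClass F ℂ (MonoidAlgebra ℂ Γ) ℂ] (ψ : F) (a : MonoidAlgebra ℂ Γ) :
    ψ a = MonoidAlgebra.functional (fun g => ψ (MonoidAlgebra.of ℂ Γ g)) a := by
  induction a using MonoidAlgebra.induction_linear with
  | zero => simp
  | add a b ha hb => simp [map_add, ha, hb]
  | single g c =>
    classical
    have : MonoidAlgebra.single g c = c • MonoidAlgebra.of ℂ Γ g := by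
      simp [MonoidAlgebra.of_apply, MonoidAlgebra.smul_single]
    rw [this, map_smul, map_smul]
    congr 1
    simp [MonoidAlgebra.functional_apply, MonoidAlgebra.of_apply, Finsupp.single_apply]

end GroupAlgebraCoefficients

/-! ### Magic corepresentations of `ℂ[Γ]`. -/

section MagicCorepresentation

variable {Γ V : Type*} [Fintype V] {v : Matrix V V (MonoidAlgebra ℂ Γ)}

/-- The Fourier coefficients of a matrix corepresentation of the group algebra are pairwise
orthogonal idempotents. -/
theorem sum_coeff_mul_coeff [DecidableEq Γ]
    (hv : ∀ i j, Coalgebra.comul (R := ℂ) (v i j) = ∑ k, v i k ⊗ₜ[ℂ] v k j) (g h : Γ) (i j : V) :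
    ∑ k, (v i k).coeff g * (v k j).coeff h = if g = h then (v i j).coeff g else 0 := by
  let c (g : Γ) : MonoidAlgebra ℂ Γ →ₗ[ℂ] ℂ :=
    { toFun := fun a => a.coeff g
      map_add' := fun _ _ => rfl
      map_smul' := fun _ _ => rfl }
  have hc (g : Γ) (a : MonoidAlgebra ℂ Γ) : c g a = a.coeff g := rfl
  -- As `Δ(m) = m ⊗ m`, reading off the coefficient of `g ⊗ h` in `Δ(a)` gives zero unless `g = h`.
  let L : MonoidAlgebra ℂ Γ ⊗[ℂ] MonoidAlgebra ℂ Γ →ₗ[ℂ] ℂ :=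
    LinearMap.mul' ℂ ℂ ∘ₗ TensorProduct.map (c g) (c h)
  have hL (a : MonoidAlgebra ℂ Γ) :
      L (Coalgebra.comul (R := ℂ) a) = if g = h then a.coeff g else 0 := by
    induction a using MonoidAlgebra.induction_linear with
    | zero => simp
    | add a b ha hb => rw [map_add, map_add, ha, hb]; split_ifs <;> simp
    | single m r =>
      simp only [MonoidAlgebra.comul_single, CommSemiring.comul_apply, TensorProduct.map_tmul,
        MonoidAlgebra.lsingle_apply, L, LinearMap.comp_apply, LinearMap.mul'_apply, hc,
        MonoidAlgebra.coeff_single, Finsupp.single_apply]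
      split_ifs <;> simp_all
  rw [← hL, hv, map_sum]
  rfl

variable [Group Γ] [Fintype Γ]

/-- The group elements that occur in one row of a magic corepresentation commute. -/
theorem commute_of_coeff_ne_zero (hmagic : IsMagic v)
    (hv : ∀ i j, Coalgebra.comul (R := ℂ) (v i j) = ∑ k, v i k ⊗ₜ[ℂ] v k j)
    {i s t : V} {g h : Γ} (hg : (v i s).coeff g ≠ 0) (hh : (v i t).coeff h ≠ 0) : Commute g h := by
  classical
  -- Compare coefficients at `m` in `v i j * v i k = δ_jk v i j`, contracted with `P_g` in `j` and
  -- `P_h` in `k`; orthogonality of the idempotents leaves only the pair `(g, h)`.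
  have key (g h : Γ) (s t : V) (m : Γ) :
      ∑ j, (v i j).coeff m * ((v j s).coeff g * (v j t).coeff h) =
        if g * h = m then (v i s).coeff g * (v i t).coeff h else 0 := by
    have hmul (j k : V) : (v i j * v i k).coeff m = if j = k then (v i j).coeff m else 0 := by
      split_ifs with hjk
      · rw [← hjk, (hmagic.isStarProjection i j).isIdempotentElem.eq]
      · rw [MonoidAlgebra.mul_eq_zero_of_sum_eq_one (hmagic.isStarProjection i)
          (hmagic.row_sum i) hjk]
        rfl
    calc ∑ j, (v i j).coeff m * ((v j s).coeff g * (v j t).coeff h)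
        = ∑ j, ∑ k, (v i j * v i k).coeff m * ((v j s).coeff g * (v k t).coeff h) := by
          simp [hmul]
      _ = ∑ j, ∑ k, ∑ a, ∑ b, if a * b = m then
            ((v i j).coeff a * (v j s).coeff g) * ((v i k).coeff b * (v k t).coeff h) else 0 := by
          refine Finset.sum_congr rfl fun j _ => Finset.sum_congr rfl fun k _ => ?_
          rw [MonoidAlgebra.coeff_mul_eq_sum, Finset.sum_mul]
          refine Finset.sum_congr rfl fun a _ => ?_
          rw [Finset.sum_mul]
          refine Finset.sum_congr rfl fun b _ => ?_
          split_ifs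
          · ring
          · simp
      _ = ∑ a, ∑ b, if a * b = m then (∑ j, (v i j).coeff a * (v j s).coeff g) *
            (∑ k, (v i k).coeff b * (v k t).coeff h) else 0 := by
          simp only [Finset.sum_mul_sum]
          rw [Finset.sum_congr rfl fun j _ => Finset.sum_comm, Finset.sum_comm]
          refine Finset.sum_congr rfl fun a _ => ?_
          rw [Finset.sum_congr rfl fun j _ => Finset.sum_comm, Finset.sum_comm]
          refine Finset.sum_congr rfl fun b _ => ?_
          split_ifs <;> simp
      _ = _ := by
          simp only [sum_coeff_mul_coeff hv]
          rw [Finset.sum_eq_single g (by simp +contextual) (by simp),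
            Finset.sum_eq_single h (by simp +contextual [eq_comm]) (by simp)]
          simp
  -- The left side of `key` is symmetric under exchanging `(g, s)` and `(h, t)`, the right side only
  -- if `g * h = h * g` or a coefficient vanishes.
  have h1 := key g h s t (g * h)
  have h2 := key h g t s (g * h)
  simp only [if_true, mul_comm ((v _ t).coeff h)] at h1 h2
  rw [h1] at h2
  by_contra hne
  rw [if_neg (fun h => hne h.symm)] at h2
  exact mul_ne_zero hg hh h2

end MagicCorepresentation

/-! ### Extension of characters from centralizers, and the resulting obstruction. -/

/-- Induction on the `*`-algebra generated by the entries of the fundamental matrix. -/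
theorem QuantumAutPoly.induction {V : Type} [Fintype V] {X : SimpleGraph V}
    {p : QuantumAutPoly X → Prop} (entry : ∀ i j, p (QuantumAutPoly.u X i j))
    (algebraMap : ∀ r : ℂ, p (algebraMap ℂ (QuantumAutPoly X) r))
    (add : ∀ x y, p x → p y → p (x + y)) (mul : ∀ x y, p x → p y → p (x * y))
    (star : ∀ x, p x → p (star x)) (a : QuantumAutPoly X) : p a :=
  StarAlgebra.adjoin_induction_subtype a (by rintro _ ⟨i, j, rfl⟩; exact entry i j)
    algebraMap add mul star

/-- If commuting is transitive on the nontrivial elements of a finite group `Γ` whose dual is the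
quantum automorphism group of a finite graph, then every character of a centralizer agrees, on a
generating set `S` of `Γ`, with a character of `Γ` that is trivial on the rest of `S`. -/
theorem HasFruchtProperty.exists_extension {Γ : Type*} [Group Γ] [Finite Γ]
    (hct : ∀ g h k : Γ, h ≠ 1 → Commute g h → Commute h k → Commute g k)
    (hF : HasFruchtProperty (MonoidAlgebra ℂ Γ)) :
    ∃ S : Set Γ, Subgroup.closure S = ⊤ ∧
      ∀ c : Γ, c ≠ 1 → ∀ χ : Subgroup.centralizer {c} →* ℂˣ, ∃ ψ : Γ →* ℂˣ,
        (∀ g (hg : g ∈ Subgroup.centralizer {c}), g ∈ S → ψ g = χ ⟨g, hg⟩) ∧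
        ∀ g ∉ Subgroup.centralizer {c}, g ∈ S → ψ g = 1 := by
  classical
  have := Fintype.ofFinite Γ
  obtain ⟨N, X, φ, hφ⟩ := hF
  let v : Matrix (Fin N) (Fin N) (MonoidAlgebra ℂ Γ) := fun i j => φ (QuantumAutPoly.u X i j)
  have hcomul : ∀ i j, Coalgebra.comul (R := ℂ) (v i j) = ∑ k, v i k ⊗ₜ[ℂ] v k j := hφ
  have hu := QuantumAutAlgebra.isQuantumAut X
  have hmagic : IsMagic v := by
    refine ⟨fun i j => ⟨?_, ?_⟩, fun i => ?_, fun j => ?_⟩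
    · rw [IsIdempotentElem, ← map_mul]
      exact congrArg φ (Subtype.ext (hu.isMagic.isStarProjection i j).isIdempotentElem)
    · rw [IsSelfAdjoint, ← map_star]
      exact congrArg φ (Subtype.ext (hu.isMagic.isStarProjection i j).isSelfAdjoint)
    · rw [← map_sum, ← map_one φ]
      refine congrArg φ (Subtype.ext ?_)
      rw [AddSubmonoidClass.coe_finsetSum]
      exact hu.isMagic.row_sum i
    · rw [← map_sum, ← map_one φ]
      refine congrArg φ (Subtype.ext ?_)
      rw [AddSubmonoidClass.coe_finsetSum]
      exact hu.isMagic.col_sum j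
  have hadj (i j : Fin N) :
      ∑ k ∈ X.neighborFinset i, v k j = ∑ k ∈ X.neighborFinset j, v i k := by
    have h := congrFun (congrFun hu.adj_comm i) j
    simp only [SimpleGraph.adjMatrix_mul_apply, SimpleGraph.mul_adjMatrix_apply] at h
    rw [← map_sum, ← map_sum]
    refine congrArg φ (Subtype.ext ?_)
    rw [AddSubmonoidClass.coe_finsetSum, AddSubmonoidClass.coe_finsetSum]
    exact h
  let S : Set Γ := {g | ∃ i j, (v i j).coeff g ≠ 0}
  refine ⟨S, ?_, fun c hc χ => ?_⟩
  · have hsupp (a : QuantumAutPoly X) (g : Γ) (hg : (φ a).coeff g ≠ 0) :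
        g ∈ Subgroup.closure S := by
      induction a using QuantumAutPoly.induction generalizing g with
      | entry i j => exact Subgroup.subset_closure ⟨i, j, hg⟩
      | algebraMap r =>
        have h : φ (algebraMap ℂ _ r) = algebraMap ℂ _ r := AlgHomClass.commutes φ r
        rw [h, MonoidAlgebra.coe_algebraMap] at hg
        by_cases h1 : g = 1
        · exact h1 ▸ one_mem _
        · simp [Ne.symm h1] at hg
      | add x y hx hy =>
        rw [map_add] at hg
        by_cases h1 : (φ x).coeff g = 0
        · refine hy g fun h2 => hg ?_
          simp [h1, h2]
        · exact hx g h1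
      | mul x y hx hy =>
        rw [map_mul, MonoidAlgebra.coeff_mul_eq_sum] at hg
        obtain ⟨a, -, ha⟩ := Finset.exists_ne_zero_of_sum_ne_zero hg
        obtain ⟨b, -, hb⟩ := Finset.exists_ne_zero_of_sum_ne_zero ha
        rw [ne_eq, ite_eq_right_iff, not_forall] at hb
        obtain ⟨rfl, hb⟩ := hb
        exact mul_mem (hx a (left_ne_zero_of_mul hb)) (hy b (right_ne_zero_of_mul hb))
      | star x hx =>
        rw [map_star, MonoidAlgebra.coeff_star_apply] at hg
        exact inv_mem_iff.mp (hx g⁻¹ fun h => hg (by simp [h]))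
    refine (Subgroup.eq_top_iff' _).mpr fun g => hsupp (φ.symm (MonoidAlgebra.of ℂ Γ g)) g ?_
    simp [MonoidAlgebra.of_apply]
  · let f : Γ → ℂ := fun g =>
      if hg : g ∈ Subgroup.centralizer {c} then ((χ ⟨g, hg⟩ : ℂˣ) : ℂ) else 1
    have hf_mem (g : Γ) (hg : g ∈ Subgroup.centralizer {c}) : f g = (χ ⟨g, hg⟩ : ℂˣ) := dif_pos hg
    have hf_notMem (g : Γ) (hg : g ∉ Subgroup.centralizer {c}) : f g = 1 := dif_neg hg
    have hf_one : f 1 = 1 := by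
      rw [hf_mem 1 (one_mem _), show (⟨1, one_mem _⟩ : Subgroup.centralizer {c}) = 1 from rfl]
      simp
    have hmem (g h : Γ) (hg : g ≠ 1) (hgh : Commute g h) (hgc : g ∈ Subgroup.centralizer {c}) :
        h ∈ Subgroup.centralizer {c} := by
      rw [Subgroup.mem_centralizer_singleton_iff] at hgc ⊢
      exact hct h g c hg hgh.symm hgc
    let w : Matrix (Fin N) (Fin N) ℂ := fun i j => MonoidAlgebra.functional f (v i j)
    have hproj (i j : Fin N) : IsStarProjection (w i j) := by
      have hcomm (g h : Γ) (hg : (v i j).coeff g ≠ 0) (hh : (v i j).coeff h ≠ 0) : Commute g h :=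
        commute_of_coeff_ne_zero hmagic hcomul hg hh
      -- By transitivity the support of an entry either lies in the centralizer, where `f` is `χ`,
      -- or meets it at most in `1`, where `f` may be replaced by the constant `1`.
      by_cases hex : ∃ g, g ≠ 1 ∧ (v i j).coeff g ≠ 0 ∧ g ∈ Subgroup.centralizer {c}
      · obtain ⟨a, ha, hva, hac⟩ := hex
        have hin (g : Γ) (hg : (v i j).coeff g ≠ 0) : g ∈ Subgroup.centralizer {c} :=
          hmem a g ha (hcomm a g hva hg) hac
        refine MonoidAlgebra.isStarProjection_functional (hmagic.isStarProjection i j)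
          (fun g h hg hh => ?_) fun g hg => ?_
        · rw [hf_mem g (hin g hg), hf_mem h (hin h hh),
            hf_mem _ (mul_mem (hin g hg) (hin h hh)), ← Units.val_mul, ← map_mul]
          rfl
        · rw [hf_mem g (hin g hg), hf_mem _ (inv_mem (hin g hg))]
          rw [show (⟨g⁻¹, inv_mem (hin g hg)⟩ : Subgroup.centralizer {c}) = ⟨g, hin g hg⟩⁻¹ from rfl,
            map_inv, Units.val_inv_eq_inv_val]
          refine Complex.inv_eq_conj (Complex.norm_eq_one_of_pow_eq_one
            (n := Nat.card (Subgroup.centralizer {c})) ?_ Nat.card_pos.ne')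
          rw [← Units.val_pow_eq_pow_val, ← map_pow, pow_card_eq_one', map_one, Units.val_one]
      · have hw : w i j = MonoidAlgebra.functional (fun _ => 1) (v i j) := by
          refine Finset.sum_congr rfl fun g _ => ?_
          by_cases hg : (v i j).coeff g = 0
          · simp [hg]
          by_cases hg1 : g = 1
          · rw [hg1, hf_one]
          · rw [hf_notMem g fun hgc => hex ⟨g, hg1, hg, hgc⟩]
        rw [hw]
        exact MonoidAlgebra.isStarProjection_functional (hmagic.isStarProjection i j)
          (fun _ _ _ _ => by simp) fun _ _ => by simp
    have hw : IsQuantumAut X w := by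
      refine ⟨⟨hproj, fun i => ?_, fun j => ?_⟩, Matrix.ext fun i j => ?_⟩
      · rw [← map_sum, hmagic.row_sum, MonoidAlgebra.functional_one hf_one]
      · rw [← map_sum, hmagic.col_sum, MonoidAlgebra.functional_one hf_one]
      · rw [SimpleGraph.adjMatrix_mul_apply, SimpleGraph.mul_adjMatrix_apply]
        have h := congrArg (MonoidAlgebra.functional f) (hadj i j)
        rw [map_sum, map_sum] at h
        convert h
    obtain ⟨F, hFu, -⟩ := QuantumAutAlgebra.existsUnique_lift X w hw
    let Ψ : MonoidAlgebra ℂ Γ →ₐ[ℂ] ℂ :=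
      ((F.comp (QuantumAutPoly X).subtype).comp (φ.symm : MonoidAlgebra ℂ Γ →⋆ₐ[ℂ] _)).toAlgHom
    have hΨ (i j : Fin N) : Ψ (v i j) = w i j := by
      change F ((φ.symm (φ (QuantumAutPoly.u X i j)) : QuantumAutPoly X) : QuantumAutAlgebra X) = _
      rw [StarAlgEquiv.symm_apply_apply]
      exact hFu i j
    let ψ : Γ →* ℂˣ := MonoidHom.toHomUnits ((Ψ : MonoidAlgebra ℂ Γ →* ℂ).comp
      (MonoidAlgebra.of ℂ Γ))
    have hψ (g : Γ) : ((ψ g : ℂˣ) : ℂ) = Ψ (MonoidAlgebra.of ℂ Γ g) := rfl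
    have hψf (g : Γ) (hg : g ∈ S) : ((ψ g : ℂˣ) : ℂ) = f g := by
      obtain ⟨i, j, hij⟩ := hg
      -- Orthogonality gives `f(v) P_g = f(g) P_g`, so the values on the entries of `v` determine
      -- `f` at every `g` with `P_g ≠ 0`.
      have hrec (f : Γ → ℂ) :
          ∑ k, MonoidAlgebra.functional f (v i k) * (v k j).coeff g = f g * (v i j).coeff g := by
        simp only [MonoidAlgebra.functional_apply, Finset.sum_mul, mul_assoc]
        rw [Finset.sum_comm]
        simp only [← Finset.mul_sum, sum_coeff_mul_coeff hcomul]
        simp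
      refine mul_right_cancel₀ hij ?_
      rw [← hrec f, hψ, ← hrec fun g => Ψ (MonoidAlgebra.of ℂ Γ g)]
      refine Finset.sum_congr rfl fun k _ => ?_
      rw [← MonoidAlgebra.functional_of_map Ψ, hΨ]
    refine ⟨ψ, fun g hg hgS => ?_, fun g hg hgS => ?_⟩
    · exact Units.ext ((hψf g hgS).trans (hf_mem g hg))
    · exact Units.ext ((hψf g hgS).trans (hf_notMem g hg))

/-- The dual of a finite nonabelian group does not have the Frucht property if commuting is
transitive on the nontrivial elements of the group and all its nontrivial characters have the same
kernel. -/
theorem not_hasFruchtProperty_of_commute_trans {Γ : Type*} [Group Γ] [Finite Γ]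
    (hct : ∀ g h k : Γ, h ≠ 1 → Commute g h → Commute h k → Commute g k)
    (hker : ∀ ψ₁ ψ₂ : Γ →* ℂˣ, ψ₁ ≠ 1 → ψ₁.ker ≤ ψ₂.ker)
    (hne : ∃ g h : Γ, ¬ Commute g h) : ¬ HasFruchtProperty (MonoidAlgebra ℂ Γ) := by
  intro hF
  obtain ⟨S, hS, hext⟩ := hF.exists_extension hct
  obtain ⟨g, hg, h, hh, hgh⟩ : ∃ g ∈ S, ∃ h ∈ S, ¬ Commute g h := by
    by_contra! hcomm
    obtain ⟨g, h, hgh⟩ := hne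
    have := Subgroup.isMulCommutative_closure hcomm
    have hmem (x : Γ) : x ∈ Subgroup.closure S := hS ▸ Subgroup.mem_top x
    exact hgh (congrArg Subtype.val (mul_comm' (⟨g, hmem g⟩ : Subgroup.closure S) ⟨h, hmem h⟩))
  have hsep (a b : Γ) (ha : a ∈ S) (hb : b ∈ S) (hab : ¬ Commute a b) :
      ∃ ψ : Γ →* ℂˣ, ψ a ≠ 1 ∧ ψ b = 1 := by
    have ha1 : a ≠ 1 := by
      rintro rfl
      exact hab (Commute.one_left b)
    -- Transitivity makes the centralizer abelian, so its characters separate `a` from `1`.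
    let _ : CommGroup (Subgroup.centralizer {a}) :=
      { (inferInstance : Group (Subgroup.centralizer {a})) with
        mul_comm := fun x y => Subtype.ext (hct x a y ha1
          (Subgroup.mem_centralizer_singleton_iff.mp x.2)
          (Subgroup.mem_centralizer_singleton_iff.mp y.2).symm) }
    have hmem : a ∈ Subgroup.centralizer {a} := Subgroup.mem_centralizer_singleton_iff.mpr rfl
    obtain ⟨χ, hχ⟩ := CommGroup.exists_apply_ne_one_of_hasEnoughRootsOfUnity
      (Subgroup.centralizer {a}) ℂ (a := ⟨a, hmem⟩) fun h => ha1 (congrArg Subtype.val h)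
    obtain ⟨ψ, hψ, hψ'⟩ := hext a ha1 χ
    refine ⟨ψ, by rwa [hψ a hmem ha], hψ' b (fun h => hab ?_) hb⟩
    exact (Subgroup.mem_centralizer_singleton_iff.mp h).symm
  obtain ⟨ψ₁, h₁g, h₁h⟩ := hsep g h hg hh hgh
  obtain ⟨ψ₂, h₂h, -⟩ := hsep h g hh hg fun h => hgh h.symm
  exact h₂h (hker ψ₁ ψ₂ (by rintro rfl; exact h₁g rfl) h₁h)

/-- No subgroup lies strictly between the commutator subgroup and `G`, so the kernel of a nontrivial
`ψ₁` is the commutator subgroup itself. -/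
theorem MonoidHom.ker_le_ker_of_prime_index_commutator {G A : Type*} [Group G] [CommGroup A]
    (hG : (commutator G).index.Prime) (ψ₁ ψ₂ : G →* A) (h : ψ₁ ≠ 1) : ψ₁.ker ≤ ψ₂.ker := by
  have hle := Abelianization.commutator_subset_ker ψ₁
  have hmul := Subgroup.relIndex_mul_index hle
  have hrel : (commutator G).relIndex ψ₁.ker = 1 := by
    refine ((Nat.dvd_prime hG).mp (hmul ▸ dvd_mul_right _ _)).resolve_right fun hp => ?_
    rw [hp] at hmul
    refine h (MonoidHom.ker_eq_top_iff.mp (Subgroup.index_eq_one.mp ?_))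
    exact Nat.eq_of_mul_eq_mul_left hG.pos (hmul.trans (mul_one _).symm)
  exact (Subgroup.relIndex_eq_one.mp hrel).trans (Abelianization.commutator_subset_ker ψ₂)

/-! ### Transitivity of commuting and abelianizations for `S₃`, `A₄`, `A₅`. -/

section SmallGroups

open Equiv Equiv.Perm

theorem commute_trans_perm_three (g h k : Perm (Fin 3)) (hh : h ≠ 1) (hgh : Commute g h)
    (hhk : Commute h k) : Commute g k := by
  have key : ∀ g h k : Perm (Fin 3), h ≠ 1 → g * h = h * g → h * k = k * h → g * k = k * g := by
    decide
  exact key g h k hh hgh hhk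

theorem index_commutator_perm_three : (commutator (Perm (Fin 3))).index = 2 := by
  have key : ∀ g : Perm (Fin 3), sign g = 1 → ∃ a b : Perm (Fin 3), a * b * a⁻¹ * b⁻¹ = g := by
    decide
  have h : commutator (Perm (Fin 3)) = alternatingGroup (Fin 3) := by
    refine le_antisymm alternatingGroup.commutator_perm_le fun g hg => ?_
    obtain ⟨a, b, rfl⟩ := key g (mem_alternatingGroup.mp hg)
    exact Subgroup.commutator_mem_commutator (Subgroup.mem_top a) (Subgroup.mem_top b)
  rw [h, alternatingGroup.index_eq_two]

set_option maxRecDepth 100000 in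
theorem commute_trans_alternatingGroup_four (g h k : alternatingGroup (Fin 4)) (hh : h ≠ 1)
    (hgh : Commute g h) (hhk : Commute h k) : Commute g k := by
  have key : ∀ h : Perm (Fin 4), h ≠ 1 → sign h = 1 → ∀ g, g * h = h * g → sign g = 1 →
      ∀ k, h * k = k * h → sign k = 1 → g * k = k * g := by
    decide
  exact Subtype.ext (key h (fun h1 => hh (Subtype.ext h1)) h.2 g (congrArg Subtype.val hgh) g.2 k
    (congrArg Subtype.val hhk) k.2)

theorem index_commutator_alternatingGroup_four :
    (commutator (alternatingGroup (Fin 4))).index = 3 := by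
  have h4 : Nat.card (Fin 4) = 4 := by simp
  have h := (commutator (alternatingGroup (Fin 4))).card_mul_index
  rw [← alternatingGroup.kleinFour_eq_commutator h4,
    alternatingGroup.kleinFour_card_of_card_eq_four h4, nat_card_alternatingGroup, h4] at h
  rw [← alternatingGroup.kleinFour_eq_commutator h4]
  simp [Nat.factorial] at h
  omega

/-- Representatives of the conjugacy classes in `S₅` of the nontrivial even permutations. -/
def evenPermFiveRepresentatives : List (Perm (Fin 5)) :=
  [c[0, 1, 2], c[0, 1] * c[2, 3], c[0, 1, 2, 3, 4]]

set_option maxRecDepth 100000 in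
theorem exists_conj_evenPermFiveRepresentatives : ∀ h : Perm (Fin 5), sign h = 1 → h ≠ 1 →
    ∃ σ : Perm (Fin 5), ∃ r ∈ evenPermFiveRepresentatives, σ * r = h * σ := by
  decide +kernel

set_option maxRecDepth 100000 in
theorem commute_of_mem_evenPermFiveRepresentatives : ∀ r ∈ evenPermFiveRepresentatives,
    ∀ g, g * r = r * g → sign g = 1 → ∀ k, k * r = r * k → sign k = 1 → g * k = k * g := by
  decide +kernel

/-- Conjugation preserves sign and commutation, so the middle element may be taken among three
representatives. Conjugating in `S₅` rather than `A₅` keeps the 5-cycles in one class. -/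
theorem commute_trans_alternatingGroup_five (g h k : alternatingGroup (Fin 5)) (hh : h ≠ 1)
    (hgh : Commute g h) (hhk : Commute h k) : Commute g k := by
  obtain ⟨σ, r, hr, hσ⟩ := exists_conj_evenPermFiveRepresentatives h h.2
    fun h1 => hh (Subtype.ext h1)
  have hr' : r = σ⁻¹ * h * σ := by rw [mul_assoc, ← hσ, inv_mul_cancel_left]
  have hconj (a : alternatingGroup (Fin 5)) (ha : Commute a h) :
      (σ⁻¹ * a * σ) * r = r * (σ⁻¹ * a * σ) := by
    have ha' : (a : Perm (Fin 5)) * h = h * a := congrArg Subtype.val ha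
    rw [hr']
    simp only [mul_assoc, mul_inv_cancel_left]
    rw [← mul_assoc (a : Perm (Fin 5)), ha', mul_assoc]
  have hsign (a : alternatingGroup (Fin 5)) : sign (σ⁻¹ * (a : Perm (Fin 5)) * σ) = 1 := by
    have ha : sign (a : Perm (Fin 5)) = 1 := a.2
    simp [ha]
  have key := commute_of_mem_evenPermFiveRepresentatives r hr _ (hconj g hgh) (hsign g) _
    (hconj k hhk.symm) (hsign k)
  simp only [mul_assoc, mul_inv_cancel_left] at key
  refine Subtype.ext (mul_right_cancel (b := σ) ?_)
  simpa only [Subgroup.coe_mul, mul_assoc] using mul_left_cancel key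

end SmallGroups

/-- The duals of `S₃`, `A₄` and `A₅` do not have the Frucht property. -/
theorem mainTheorem2 :
    ¬ HasFruchtProperty (MonoidAlgebra ℂ (Equiv.Perm (Fin 3))) ∧
    ¬ HasFruchtProperty (MonoidAlgebra ℂ (alternatingGroup (Fin 4))) ∧
    ¬ HasFruchtProperty (MonoidAlgebra ℂ (alternatingGroup (Fin 5))) := by
  refine ⟨not_hasFruchtProperty_of_commute_trans commute_trans_perm_three
      (MonoidHom.ker_le_ker_of_prime_index_commutator
        (index_commutator_perm_three ▸ Nat.prime_two)) ⟨c[0, 1], c[1, 2], ?_⟩,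
    not_hasFruchtProperty_of_commute_trans commute_trans_alternatingGroup_four
      (MonoidHom.ker_le_ker_of_prime_index_commutator
        (index_commutator_alternatingGroup_four ▸ Nat.prime_three))
      ⟨⟨c[0, 1, 2], ?_⟩, ⟨c[1, 2, 3], ?_⟩, ?_⟩,
    not_hasFruchtProperty_of_commute_trans commute_trans_alternatingGroup_five
      (fun ψ₁ ψ₂ _ => ?_) ⟨⟨c[0, 1, 2], ?_⟩, ⟨c[1, 2, 3], ?_⟩, ?_⟩⟩
  · unfold Commute SemiconjBy; decide
  · rw [Equiv.Perm.mem_alternatingGroup]; decide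
  · rw [Equiv.Perm.mem_alternatingGroup]; decide
  · intro h; exact absurd (congrArg Subtype.val h) (by decide)
  -- `A₅` is perfect, so `ψ₂` is trivial.
  · have h := Abelianization.commutator_subset_ker ψ₂
    rw [commutator_alternatingGroup_eq_top (by simp)] at h
    exact le_top.trans h
  · rw [Equiv.Perm.mem_alternatingGroup]; decide
  · rw [Equiv.Perm.mem_alternatingGroup]; decide
  · intro h; exact absurd (congrArg Subtype.val h) (by decide)
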